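/- Let $n\in\mathbb N$, let $p\in(2,\infty]$ and define $q$ by $\frac1q=\frac12+\frac1p$, so that $q\in(1,2]$. All function spaces are on the unit circle $\mathbb T$ with normalised Lebesgue measure. For $s\in(1,2]$ let $P_{s+}:(L^s)^n\to(H^s)^n$ be the (bounded) Riesz projection, i.e. the projection onto $(H^s)^n$ along $(\overline{H^s_0})^n=\{\overline f: f\in (H^s)^n,\ f(0)=0\}$, and let $P_{s-}=I-P_{s+}$. Let $\Theta$ be an $n\times n$ matrix inner function, i.e. a matrix with entries in $H^\infty$ such that $\Theta(z)$ is unitary for almost every $z\in\mathbb T$; put $K_\Theta^s=\Theta\,(\overline{H^s_0})^n\cap(H^s)^n$ and $P_{\Theta,s}=P_{s+}\Theta P_{s-}\Theta^*:(L^s)^n\to K_\Theta^s$. Let $G$ be an $n\times n$ matrix with entries in $L^p$. Let $\tilde A_G^\Theta:K_\Theta^2\to K_\Theta^q$ be the modified matrix-valued truncated Toeplitz operator $\tilde A_G^\Theta f=P_{\Theta,q}(Gf)$, and for $$\mathcal G=\begin{pmatrix}\Theta^*&0\\ G&\Theta\end{pmatrix}$$ let $T_{\mathcal G}$ be the operator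 on $\begin{pmatrix}(H^2)^n\\(H^q)^n\end{pmatrix}$ given by $$T_{\mathcal G}\begin{pmatrix}f_1\\f_2\end{pmatrix}=\begin{pmatrix}P_{2+}(\Theta^*f_1)\\P_{q+}(Gf_1+\Theta f_2)\end{pmatrix}.$$ Let $P_n$ denote the projection onto the first $n$ coordinates, $P_n\begin{pmatrix}f_1\\f_2\end{pmatrix}=f_1$. Then $$P_n(\ker T_{\mathcal G})=\ker\tilde A_G^\Theta .$$ -/

import Mathlib

open MeasureTheory AddCircle Set Filter Topology
open scoped ENNReal NNReal Real Matrix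

noncomputable section

namespace MTTO

instance : Fact (0 < 2 * π) := ⟨Real.two_pi_pos⟩

/-- The unit circle, parametrised by the angle `t`; the coordinate `z = e^{it}` is `fourier 1`. -/
abbrev T : Type := AddCircle (2 * π)

/-- Normalised Lebesgue measure on the unit circle. -/
abbrev m : Measure T := haarAddCircle

/-- The scalar space `L^q` of the unit circle. -/
abbrev L (q : ℝ≥0∞) : Type := Lp ℂ q m

section coeff

variable {q : ℝ≥0∞}

theorem L.integrable [hq : Fact (1 ≤ q)] (f : L q) : Integrable f m :=
  (Lp.memLp f).integrable hq.out

theorem coeff_add [Fact (1 ≤ q)] (f g : L q) (k : ℤ) :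
    fourierCoeff (f + g : L q) k = fourierCoeff f k + fourierCoeff g k := by
  rw [fourierCoeff_congr_ae (Lp.coeFn_add f g), fourierCoeff.add (L.integrable f) (L.integrable g)]
  rfl

theorem coeff_smul (c : ℂ) (f : L q) (k : ℤ) :
    fourierCoeff (c • f : L q) k = c * fourierCoeff f k := by
  rw [fourierCoeff_congr_ae (Lp.coeFn_smul c f), fourierCoeff.const_smul]
  rfl

theorem coeff_star (f : L q) (k : ℤ) :
    fourierCoeff (star f : L q) k = star (fourierCoeff f (-k)) := by
  rw [fourierCoeff_congr_ae (Lp.coeFn_star f)]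
  simp only [fourierCoeff, smul_eq_mul, Complex.star_def]
  rw [← integral_conj]
  congr 1
  ext t
  simp

theorem norm_coeff_le [hq : Fact (1 ≤ q)] (f : L q) (k : ℤ) : ‖fourierCoeff f k‖ ≤ ‖f‖ := by
  have h1 : ‖fourierCoeff f k‖ ≤ ∫ t, ‖f t‖ ∂m := by
    refine (norm_integral_le_integral_norm _).trans (le_of_eq ?_)
    congr 1
    ext t
    rw [norm_smul, fourier_apply, Circle.norm_coe, one_mul]
  refine h1.trans ?_
  rw [Lp.norm_def, integral_norm_eq_lintegral_enorm (Lp.aestronglyMeasurable f),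
    ← eLpNorm_one_eq_lintegral_enorm]
  exact ENNReal.toReal_mono (Lp.memLp f).2.ne
    (eLpNorm_le_eLpNorm_of_exponent_le hq.out (Lp.aestronglyMeasurable f))

/-- The `k`-th Fourier coefficient as a continuous functional. -/
def coeffL (q : ℝ≥0∞) [Fact (1 ≤ q)] (k : ℤ) : L q →L[ℂ] ℂ :=
  LinearMap.mkContinuous
    { toFun := fun f => fourierCoeff f k
      map_add' := fun f g => coeff_add f g k
      map_smul' := fun c f => coeff_smul c f k } 1 (fun f => by simpa using norm_coeff_le f k)

@[simp] theorem coeffL_apply [Fact (1 ≤ q)] (f : L q) (k : ℤ) : coeffL q k f = fourierCoeff f k := rfl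

end coeff

/-- The Hardy space `H^q`, as the space of its boundary functions: the functions in `L^q` whose
Fourier coefficients of negative index vanish. -/
def hardy (q : ℝ≥0∞) [Fact (1 ≤ q)] : Submodule ℂ (L q) where
  carrier := {f | ∀ k : ℤ, k < 0 → fourierCoeff f k = 0}
  add_mem' := fun {f g} hf hg k hk => by rw [coeff_add, hf k hk, hg k hk, add_zero]
  zero_mem' := fun k _ => (coeffL q k).map_zero
  smul_mem' := fun c f hf k hk => by rw [coeff_smul, hf k hk, mul_zero]

theorem mem_hardy {q : ℝ≥0∞} [Fact (1 ≤ q)] {f : L q} :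
    f ∈ hardy q ↔ ∀ k : ℤ, k < 0 → fourierCoeff f k = 0 := Iff.rfl

theorem star_add' {q : ℝ≥0∞} (f g : L q) : star (f + g) = star f + star g := by
  ext1
  filter_upwards [Lp.coeFn_star (f + g), Lp.coeFn_star f, Lp.coeFn_star g, Lp.coeFn_add f g,
    Lp.coeFn_add (star f) (star g)] with t h1 h2 h3 h4 h5
  rw [h1, h5, Pi.star_apply, h4, Pi.add_apply, Pi.add_apply, h2, h3, star_add, Pi.star_apply,
    Pi.star_apply]

theorem star_smul' {q : ℝ≥0∞} (c : ℂ) (f : L q) : star (c • f) = star c • star f := by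
  ext1
  filter_upwards [Lp.coeFn_star (c • f), Lp.coeFn_star f, Lp.coeFn_smul c f,
    Lp.coeFn_smul (star c) (star f)] with t h1 h2 h3 h4
  rw [h1, h4, Pi.star_apply, h3, Pi.smul_apply, Pi.smul_apply, h2, star_smul, Pi.star_apply]

/-- The space of the complex conjugates of those `f ∈ H^q` that vanish at the origin: the value of
`f` at `0` is its zeroth Fourier coefficient. -/
def coHardy (q : ℝ≥0∞) [Fact (1 ≤ q)] : Submodule ℂ (L q) where
  carrier := {g | ∃ f ∈ hardy q, fourierCoeff f 0 = 0 ∧ star f = g}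
  add_mem' := by
    rintro _ _ ⟨f, hf, hf0, rfl⟩ ⟨g, hg, hg0, rfl⟩
    exact ⟨f + g, add_mem hf hg, by rw [coeff_add, hf0, hg0, add_zero], star_add' f g⟩
  zero_mem' := ⟨0, zero_mem _, (coeffL q 0).map_zero, by simpa using star_smul' (0 : ℂ) (0 : L q)⟩
  smul_mem' := by
    rintro c _ ⟨f, hf, hf0, rfl⟩
    refine ⟨star c • f, Submodule.smul_mem _ _ hf, by rw [coeff_smul, hf0, mul_zero], ?_⟩
    rw [star_smul', star_star]

theorem mem_coHardy {q : ℝ≥0∞} [Fact (1 ≤ q)] {g : L q} :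
    g ∈ coHardy q ↔ ∀ k : ℤ, 0 ≤ k → fourierCoeff g k = 0 := by
  constructor
  · rintro ⟨f, hf, hf0, rfl⟩ k hk
    rw [coeff_star]
    rcases hk.eq_or_lt with rfl | hk
    · simp [hf0]
    · simp [hf (-k) (by lia)]
  · intro h
    refine ⟨star g, fun k hk => ?_, ?_, star_star g⟩
    · rw [coeff_star, h (-k) (by lia), star_zero]
    · rw [coeff_star, h _ (by simp), star_zero]

theorem isClosed_hardy (q : ℝ≥0∞) [Fact (1 ≤ q)] : IsClosed (hardy q : Set (L q)) := by
  have : (hardy q : Set (L q)) = ⋂ (k : ℤ) (_ : k < 0), (coeffL q k) ⁻¹' {0} := by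
    ext f; simp [mem_hardy]
  rw [this]
  exact isClosed_biInter fun k _ => isClosed_singleton.preimage (coeffL q k).continuous

theorem isClosed_coHardy (q : ℝ≥0∞) [Fact (1 ≤ q)] : IsClosed (coHardy q : Set (L q)) := by
  have : (coHardy q : Set (L q)) = ⋂ (k : ℤ) (_ : 0 ≤ k), (coeffL q k) ⁻¹' {0} := by
    ext f; simp [mem_coHardy]
  rw [this]
  exact isClosed_biInter fun k _ => isClosed_singleton.preimage (coeffL q k).continuous

/-- A function in `L^q` is determined by its Fourier coefficients. -/
theorem eq_zero_of_coeff {q : ℝ≥0∞} [Fact (1 ≤ q)] (f : L q)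
    (h : ∀ k : ℤ, fourierCoeff f k = 0) : f = 0 := by
  have hf := L.integrable f
  have hint : ∀ g : C(T, ℂ), Integrable (fun t => g t * f t) m := fun g =>
    hf.bdd_mul (c := ‖g‖) g.continuous.aestronglyMeasurable
      (ae_of_all _ fun t => g.norm_coe_le_norm t)
  let Φ : C(T, ℂ) →L[ℂ] ℂ := LinearMap.mkContinuous
    { toFun := fun g => ∫ t, g t * f t ∂m
      map_add' := fun g g' => by
        simp only [ContinuousMap.add_apply, add_mul]
        exact integral_add (hint g) (hint g')
      map_smul' := fun c g => by
        simp only [ContinuousMap.smul_apply, smul_eq_mul, mul_assoc, RingHom.id_apply]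
        exact integral_const_mul c _ } (∫ t, ‖f t‖ ∂m) (fun g => by
      refine (norm_integral_le_integral_norm _).trans ?_
      refine le_of_le_of_eq (integral_mono (hint g).norm (hf.norm.const_mul ‖g‖) fun t => ?_)
        ((integral_const_mul _ _).trans (mul_comm _ _))
      simp only [norm_mul]
      gcongr
      exact g.norm_coe_le_norm t)
  have hΦ : ∀ g : C(T, ℂ), ∫ t, g t * f t ∂m = 0 := by
    intro g
    have hle : (Submodule.span ℂ (range (@fourier (2 * π)))).topologicalClosure
        ≤ LinearMap.ker Φ.toLinearMap := by
      refine Submodule.topologicalClosure_minimal _ ?_ Φ.isClosed_ker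
      rw [Submodule.span_le]
      rintro _ ⟨k, rfl⟩
      have := h (-k)
      rw [fourierCoeff, neg_neg] at this
      exact this
    rw [span_fourier_closure_eq_top] at hle
    exact hle (Submodule.mem_top (x := g))
  rw [Lp.eq_zero_iff_ae_eq_zero]
  refine ae_eq_zero_of_forall_setIntegral_isClosed_eq_zero hf fun s hs => ?_
  let δ : ℕ → ℝ := fun n => 1 / ((n : ℝ) + 1)
  have hδ : ∀ n, 0 < δ n := fun n => Nat.one_div_pos_of_nat
  have hlim := tendsto_pi_nhds.1 (thickenedIndicator_tendsto_indicator_closure hδ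
    tendsto_one_div_add_atTop_nhds_zero_nat s)
  have h0 : ∀ n, ∫ t, ((thickenedIndicator (hδ n) s t : ℝ) : ℂ) * f t ∂m = 0 := fun n =>
    hΦ ⟨fun t => ((thickenedIndicator (hδ n) s t : ℝ) : ℂ), by fun_prop⟩
  have key : Tendsto (fun n => ∫ t, ((thickenedIndicator (hδ n) s t : ℝ) : ℂ) * f t ∂m) atTop
      (𝓝 (∫ t, s.indicator f t ∂m)) := by
    refine tendsto_integral_of_dominated_convergence (fun t => ‖f t‖) (fun n => ?_) hf.norm
      (fun n => ae_of_all _ fun t => ?_) (ae_of_all _ fun t => ?_)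
    · refine AEStronglyMeasurable.mul (Continuous.aestronglyMeasurable (by fun_prop)) hf.1
    · rw [norm_mul]
      refine mul_le_of_le_one_left (norm_nonneg _) ?_
      have := thickenedIndicator_le_one (hδ n) s t
      simpa using this
    · have := hlim t
      rw [hs.closure_eq] at this
      by_cases ht : t ∈ s
      · simp only [ht, indicator_of_mem] at this ⊢
        have h2 : Tendsto (fun n => ((thickenedIndicator (hδ n) s t : ℝ) : ℂ)) atTop
          (𝓝 (((1 : ℝ≥0) : ℝ) : ℂ)) :=
          (Complex.continuous_ofReal.comp NNReal.continuous_coe).continuousAt.tendsto.comp this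
        simpa using h2.mul_const (f t)
      · simp only [ht, indicator_of_notMem, not_false_eq_true] at this ⊢
        have h2 : Tendsto (fun n => ((thickenedIndicator (hδ n) s t : ℝ) : ℂ)) atTop
          (𝓝 (((0 : ℝ≥0) : ℝ) : ℂ)) :=
          (Complex.continuous_ofReal.comp NNReal.continuous_coe).continuousAt.tendsto.comp this
        simpa using h2.mul_const (f t)
  simp only [h0] at key
  rw [← integral_indicator hs.measurableSet]
  exact tendsto_nhds_unique key tendsto_const_nhds

theorem disjoint_hardy (q : ℝ≥0∞) [Fact (1 ≤ q)] : Disjoint (hardy q) (coHardy q) := by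
  rw [Submodule.disjoint_def]
  intro f h1 h2
  refine eq_zero_of_coeff f fun k => ?_
  rcases lt_or_ge k 0 with hk | hk
  · exact mem_hardy.1 h1 k hk
  · exact mem_coHardy.1 h2 k hk

/-! ### Boundedness of the Riesz projection -/

/-- The inclusion of `L^2` in `L^q`, for `q ≤ 2`. -/
def incl (q : ℝ≥0∞) [Fact (1 ≤ q)] (h2 : q ≤ 2) : L 2 →L[ℂ] L q :=
  LinearMap.mkContinuous
    { toFun := fun f => ((Lp.memLp f).mono_exponent h2).toLp f
      map_add' := fun f g => by
        rw [← MemLp.toLp_add]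
        exact MemLp.toLp_congr _ (((Lp.memLp f).mono_exponent h2).add ((Lp.memLp g).mono_exponent h2))
          (Lp.coeFn_add f g)
      map_smul' := fun c f => by
        rw [RingHom.id_apply, ← MemLp.toLp_const_smul]
        exact MemLp.toLp_congr _ (((Lp.memLp f).mono_exponent h2).const_smul c) (Lp.coeFn_smul c f) } 1 (fun f => by
      rw [one_mul]
      simp only [LinearMap.coe_mk, AddHom.coe_mk]
      rw [Lp.norm_toLp, Lp.norm_def]
      exact ENNReal.toReal_mono (Lp.memLp f).2.ne
        (eLpNorm_le_eLpNorm_of_exponent_le h2 (Lp.aestronglyMeasurable f)))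

theorem coeFn_incl (q : ℝ≥0∞) [Fact (1 ≤ q)] (h2 : q ≤ 2) (f : L 2) : incl q h2 f =ᵐ[m] f :=
  MemLp.coeFn_toLp ((Lp.memLp f).mono_exponent h2)

theorem norm_incl_le (q : ℝ≥0∞) [Fact (1 ≤ q)] (h2 : q ≤ 2) (f : L 2) : ‖incl q h2 f‖ ≤ ‖f‖ := by
  have := (incl q h2).le_of_opNorm_le (LinearMap.mkContinuous_norm_le _ zero_le_one _) f
  simpa using this

theorem coeff_incl (q : ℝ≥0∞) [Fact (1 ≤ q)] (h2 : q ≤ 2) (f : L 2) (k : ℤ) :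
    fourierCoeff (incl q h2 f) k = fourierCoeff f k := by
  rw [fourierCoeff_congr_ae (coeFn_incl q h2 f)]

/-- A continuous function as an element of `L^q`. -/
abbrev toL (q : ℝ≥0∞) [Fact (1 ≤ q)] : C(T, ℂ) →L[ℂ] L q := ContinuousMap.toLp q m ℂ

theorem incl_toL (q : ℝ≥0∞) [Fact (1 ≤ q)] (h2 : q ≤ 2) (f : C(T, ℂ)) :
    incl q h2 (toL 2 f) = toL q f := by
  ext1
  filter_upwards [coeFn_incl q h2 (toL 2 f), ContinuousMap.coeFn_toLp (p := 2) (𝕜 := ℂ) m f,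
    ContinuousMap.coeFn_toLp (p := q) (𝕜 := ℂ) m f] with t h1 h2 h3
  rw [h1, h2, h3]

theorem coeff_toL (q : ℝ≥0∞) [Fact (1 ≤ q)] (f : C(T, ℂ)) (k : ℤ) :
    fourierCoeff (toL q f) k = fourierCoeff f k := by
  rw [fourierCoeff_congr_ae (ContinuousMap.coeFn_toLp (p := q) (𝕜 := ℂ) m f)]

theorem norm_toL_le (q : ℝ≥0∞) [Fact (1 ≤ q)] (f : C(T, ℂ)) : ‖toL q f‖ ≤ ‖f‖ := by
  have h : ∀ᵐ t ∂m, ‖toL q f t‖ ≤ ‖f‖ := by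
    filter_upwards [ContinuousMap.coeFn_toLp (p := q) (𝕜 := ℂ) m f] with t h
    rw [h]
    exact f.norm_coe_le_norm t
  simpa [measureUnivNNReal] using Lp.norm_le_of_ae_bound (norm_nonneg f) h

instance : CompleteSpace (hardy 2) := (isClosed_hardy 2).completeSpace_coe

/-- The orthogonal projection of `L^2` onto `H^2`. -/
def P2 : L 2 →L[ℂ] L 2 := (hardy 2).starProjection

theorem P2_mem (f : L 2) : P2 f ∈ hardy 2 := Submodule.starProjection_apply_mem _ _

theorem norm_P2_le (f : L 2) : ‖P2 f‖ ≤ ‖f‖ := Submodule.norm_starProjection_apply_le _ _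

theorem sub_P2_mem (f : L 2) : f - P2 f ∈ coHardy 2 := by
  have h := (hardy 2).sub_starProjection_mem_orthogonal f
  rw [mem_coHardy]
  intro k hk
  rw [← fourierBasis_repr, HilbertBasis.repr_apply_apply]
  refine h _ ?_
  rw [mem_hardy]
  intro j hj
  rw [coe_fourierBasis, fourierCoeff_congr_ae (coeFn_fourierLp 2 k), fourierCoeff_fourier]
  exact Pi.single_eq_of_ne (by lia) _

theorem P2_eq {f g : L 2} (hg : g ∈ hardy 2) (hfg : f - g ∈ coHardy 2) : P2 f = g := by
  have h1 : P2 f - g ∈ hardy 2 := sub_mem (P2_mem f) hg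
  have h2 : P2 f - g ∈ coHardy 2 := by
    have := sub_mem hfg (sub_P2_mem f)
    rwa [sub_sub_sub_cancel_left] at this
  exact sub_eq_zero.1 (Submodule.disjoint_def.1 (disjoint_hardy 2) _ h1 h2)

/-- The elementary inequality behind the boundedness of the conjugate function. -/
theorem rpow_norm_le {r : ℝ} (h1 : 1 < r) (h2 : r ≤ 2) : ∃ A : ℝ, 0 ≤ A ∧ ∃ B : ℝ, 0 ≤ B ∧
    ∀ z : ℂ, 0 < z.re → ‖z‖ ^ r ≤ A * z.re ^ r - B * (z ^ (r : ℂ)).re := by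
  set γ : ℝ := (π / 2 + π / (2 * r)) / 2 with hγ
  have hr : 0 < r := by linarith
  have hpi := Real.pi_pos
  have e1 : π / (2 * r) < π / 2 := by
    apply div_lt_div_of_pos_left <;> linarith
  have e0 : 0 < π / (2 * r) := by positivity
  have e2 : π / (2 * r) * r = π / 2 := by field_simp
  have hγ1 : γ < π / 2 := by linarith
  have hγ0 : 0 < γ := by positivity
  have hγr : π / 2 < γ * r := by
    rw [← e2]; exact mul_lt_mul_of_pos_right (by linarith) hr
  have hγr2 : γ * r ≤ π := by nlinarith
  have hδ : 0 < -Real.cos (γ * r) :=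
    neg_pos.2 (Real.cos_neg_of_pi_div_two_lt_of_lt hγr (by linarith))
  have hc : 0 < Real.cos γ := Real.cos_pos_of_mem_Ioo ⟨by linarith, hγ1⟩
  have hcr : 0 < Real.cos γ ^ r := Real.rpow_pos_of_pos hc r
  set B : ℝ := 1 / (-Real.cos (γ * r)) with hB
  have hB0 : 0 < B := by positivity
  refine ⟨(1 + B) / Real.cos γ ^ r, by positivity, B, hB0.le, fun z hz => ?_⟩
  have key : ∀ θ : ℝ, 0 ≤ θ → θ ≤ π / 2 →
      1 ≤ (1 + B) / Real.cos γ ^ r * Real.cos θ ^ r - B * Real.cos (θ * r) := by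
    intro θ h0 hθ
    have hcθ : 0 ≤ Real.cos θ := Real.cos_nonneg_of_mem_Icc ⟨by linarith, hθ⟩
    rcases le_total γ θ with h | h
    · have : Real.cos (θ * r) ≤ Real.cos (γ * r) :=
        Real.cos_le_cos_of_nonneg_of_le_pi (by positivity) (by nlinarith)
          (mul_le_mul_of_nonneg_right h hr.le)
      have h3 : B * Real.cos (θ * r) ≤ B * Real.cos (γ * r) := mul_le_mul_of_nonneg_left this hB0.le
      have h4 : B * Real.cos (γ * r) = -1 := by
        have : Real.cos (γ * r) ≠ 0 := (neg_pos.1 hδ).ne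
        rw [hB]; field_simp
      have h5 : 0 ≤ (1 + B) / Real.cos γ ^ r * Real.cos θ ^ r := by positivity
      linarith
    · have h3 : Real.cos γ ^ r ≤ Real.cos θ ^ r :=
        Real.rpow_le_rpow hc.le (Real.cos_le_cos_of_nonneg_of_le_pi h0 (by linarith) h) hr.le
      have h4 : 1 + B ≤ (1 + B) / Real.cos γ ^ r * Real.cos θ ^ r := by
        rw [div_mul_eq_mul_div, le_div_iff₀ hcr]
        exact mul_le_mul_of_nonneg_left h3 (by positivity)
      have h5 : B * Real.cos (θ * r) ≤ B := mul_le_of_le_one_right hB0.le (Real.cos_le_one _)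
      linarith
  have hz0 : z ≠ 0 := by rintro rfl; simp at hz
  have habs := Complex.abs_arg_le_pi_div_two_iff.2 hz.le
  have hk := key |z.arg| (abs_nonneg _) habs
  have hcos : Real.cos (|z.arg| * r) = Real.cos (z.arg * r) := by
    rw [← abs_of_pos hr, ← abs_mul, Real.cos_abs, abs_of_pos hr]
  rw [Real.cos_abs, hcos] at hk
  have hre : z.re ^ r = ‖z‖ ^ r * Real.cos z.arg ^ r := by
    rw [← Real.mul_rpow (norm_nonneg z)
      (Real.cos_nonneg_of_mem_Icc ⟨by linarith [abs_le.1 habs], (abs_le.1 habs).2⟩),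
      Complex.norm_mul_cos_arg]
  rw [hre, Complex.cpow_ofReal_re]
  have := mul_le_mul_of_nonneg_left hk (Real.rpow_nonneg (norm_nonneg z) r)
  linarith

theorem toAddCircle_apply (P : Polynomial ℂ) (t : T) :
    P.toAddCircle t = P.eval (t.toCircle : ℂ) := by
  induction P using Polynomial.induction_on' with
  | add p q hp hq => simp [hp, hq]
  | monomial k a =>
    rw [Polynomial.toAddCircle_monomial_eq_smul_fourier]
    simp [AddCircle.toCircle_nsmul]

/-- An analytic polynomial with positive real part on the circle. -/
theorem integral_poly_le {r : ℝ} (h1 : 1 < r) (h2 : r ≤ 2) : ∃ A : ℝ, 0 ≤ A ∧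
    ∀ P : Polynomial ℂ, (P.coeff 0).im = 0 → (∀ t : T, 0 < (P.toAddCircle t).re) →
      ∫ t, ‖P.toAddCircle t‖ ^ r ∂m ≤ A * ∫ t, (P.toAddCircle t).re ^ r ∂m := by
  obtain ⟨A, hA, B, hB, h⟩ := rpow_norm_le h1 h2
  refine ⟨A, hA, fun P him hpos => ?_⟩
  have hcirc : ∀ z ∈ Metric.sphere (0 : ℂ) 1, 0 < (P.eval z).re := by
    intro z hz
    have hz1 : ‖z‖ = 1 := by simpa using hz
    have h3 := hpos ((Complex.arg z : ℝ) : T)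
    rw [toAddCircle_apply] at h3
    have h4 : ((toCircle ((Complex.arg z : ℝ) : T) : Circle) : ℂ) = z := by
      have := Complex.norm_mul_exp_arg_mul_I z
      rw [hz1] at this
      rw [toCircle_apply_mk, Circle.coe_exp]
      have e : 2 * π / (2 * π) * Complex.arg z = Complex.arg z := by
        rw [div_self Real.two_pi_pos.ne', one_mul]
      rw [e]
      simpa using this
    rwa [h4] at h3
  have hdisc : ∀ z ∈ Metric.closedBall (0 : ℂ) 1, 0 < (P.eval z).re := by
    obtain ⟨w, hw, hmin⟩ := (isCompact_sphere (0 : ℂ) 1).exists_isMinOn ⟨1, by simp⟩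
      (f := fun z => (P.eval z).re) (by fun_prop)
    intro z hz
    have := Complex.norm_le_of_forall_mem_frontier_norm_le (f := fun z => Complex.exp (-P.eval z))
      (U := Metric.ball (0 : ℂ) 1) Metric.isBounded_ball
      (Differentiable.diffContOnCl (by fun_prop)) (C := Real.exp (-(P.eval w).re)) (fun y hy => by
        rw [frontier_ball _ one_ne_zero] at hy
        rw [Complex.norm_exp, Complex.neg_re]
        exact Real.exp_le_exp.2 (neg_le_neg (hmin hy))) (z := z)
      (by rwa [closure_ball _ one_ne_zero])
    rw [Complex.norm_exp, Complex.neg_re, Real.exp_le_exp, neg_le_neg_iff] at this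
    exact (hcirc w hw).trans_le this
  have hmean : Real.circleAverage (fun z => (P.eval z) ^ (r : ℂ)) 0 1 = (P.eval 0) ^ (r : ℂ) := by
    refine DiffContOnCl.circleAverage ⟨?_, ?_⟩
    · intro z hz
      rw [abs_one] at hz
      refine DifferentiableAt.differentiableWithinAt ?_
      refine DifferentiableAt.cpow_const (by fun_prop) ?_
      exact Or.inl (hdisc z (Metric.ball_subset_closedBall hz))
    · rw [abs_one, closure_ball _ one_ne_zero]
      refine ContinuousOn.cpow_const (by fun_prop) ?_
      exact fun z hz => Or.inl (hdisc z hz)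
  have hint : ∫ t, (P.toAddCircle t) ^ (r : ℂ) ∂m = (P.coeff 0) ^ (r : ℂ) := by
    rw [Polynomial.coeff_zero_eq_eval_zero, ← hmean, AddCircle.integral_haarAddCircle,
      Real.circleAverage, ← AddCircle.intervalIntegral_preimage (2 * π) 0]
    simp [Polynomial.toAddCircle, toCircle, circleMap]
  have hcont : Continuous fun t => (P.toAddCircle t) ^ (r : ℂ) :=
    Continuous.cpow (by fun_prop) continuous_const fun t => Or.inl (hpos t)
  have hI : ∀ {E : Type} [NormedAddCommGroup E] {f : T → E}, Continuous f → Integrable f m :=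
    fun hf => by simpa using hf.continuousOn.integrableOn_compact isCompact_univ (μ := m)
  have hc1 : Continuous fun t : T => ‖P.toAddCircle t‖ ^ r :=
    Continuous.rpow_const (by fun_prop) fun t => Or.inr (by linarith)
  have hc2 : Continuous fun t : T => (P.toAddCircle t).re ^ r :=
    Continuous.rpow_const (by fun_prop) fun t => Or.inr (by linarith)
  have hre : ∫ t, ((P.toAddCircle t) ^ (r : ℂ)).re ∂m = ((P.coeff 0) ^ (r : ℂ)).re := by
    rw [← hint]
    exact integral_re (hI hcont)
  have hp0 : 0 ≤ ((P.coeff 0) ^ (r : ℂ)).re := by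
    have h0 := hdisc 0 (by simp)
    rw [← Polynomial.coeff_zero_eq_eval_zero] at h0
    have : P.coeff 0 = ((P.coeff 0).re : ℂ) := Complex.ext (by simp) (by simp [him])
    rw [this, ← Complex.ofReal_cpow h0.le, Complex.ofReal_re]
    positivity
  calc ∫ t, ‖P.toAddCircle t‖ ^ r ∂m
      ≤ ∫ t, (A * (P.toAddCircle t).re ^ r - B * ((P.toAddCircle t) ^ (r : ℂ)).re) ∂m :=
        integral_mono (hI hc1) (hI (by fun_prop)) fun t => h _ (hpos t)
    _ = A * ∫ t, (P.toAddCircle t).re ^ r ∂m - B * ((P.coeff 0) ^ (r : ℂ)).re := by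
        rw [integral_sub (hI (by fun_prop)) (hI (by fun_prop)), integral_const_mul,
          integral_const_mul, hre]
    _ ≤ _ := by
        have := mul_nonneg hB hp0
        linarith
theorem norm_toL {q : ℝ≥0∞} [Fact (1 < q)] [Fact (1 ≤ q)] [Fact (q ≤ 2)] (f : C(T, ℂ)) :
    ‖toL q f‖ = (∫ t, ‖f t‖ ^ q.toReal ∂m) ^ (q.toReal)⁻¹ := by
  have h1 : q ≠ 0 := (zero_lt_one.trans (Fact.out : 1 < q)).ne'
  have h2 : q ≠ ∞ := ((Fact.out : q ≤ 2).trans_lt ENNReal.ofNat_lt_top).ne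
  rw [Lp.norm_def, eLpNorm_congr_ae (ContinuousMap.coeFn_toLp (p := q) (𝕜 := ℂ) m f),
    MemLp.eLpNorm_eq_integral_rpow_norm h1 h2, ENNReal.toReal_ofReal (by positivity)]
  exact MemLp.ae_eq (ContinuousMap.coeFn_toLp (p := q) (𝕜 := ℂ) m f) (Lp.memLp _)

/-- The real part of a continuous function, as a complex valued function. -/
def rePart (f : C(T, ℂ)) : C(T, ℂ) := ⟨fun t => ((f t).re : ℂ), by fun_prop⟩

theorem P2_rePart (P : Polynomial ℂ) (him : (P.coeff 0).im = 0) :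
    P2 (toL 2 (rePart P.toAddCircle)) =
      toL 2 ((1 / 2 : ℂ) • (P.toAddCircle + (Polynomial.C (P.coeff 0)).toAddCircle)) := by
  have hcoef : ∀ (Q : Polynomial ℂ) (k : ℤ), fourierCoeff (toL 2 Q.toAddCircle) k =
      if 0 ≤ k then Q.coeff k.natAbs else 0 := fun Q k => by
    rw [coeff_toL, Polynomial.fourierCoeff_toAddCircle]
  have hre : toL 2 (rePart P.toAddCircle) =
      (1 / 2 : ℂ) • (toL 2 P.toAddCircle + star (toL 2 P.toAddCircle)) := by
    have : rePart P.toAddCircle = (1 / 2 : ℂ) • (P.toAddCircle + star P.toAddCircle) := by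
      ext t
      have := Complex.add_conj (P.toAddCircle t)
      simp only [rePart, ContinuousMap.coe_mk, ContinuousMap.smul_apply, ContinuousMap.add_apply,
        ContinuousMap.star_apply, Complex.star_def, this, smul_eq_mul]
      push_cast
      ring
    rw [this, map_smul, map_add]
    congr 2
  rw [hre, map_smul (toL 2), map_add (toL 2)]
  apply P2_eq
  · intro k hk
    rw [coeff_smul, coeff_add, hcoef, hcoef]
    simp [not_le.2 hk]
  · rw [← smul_sub, add_sub_add_left_eq_sub, sub_eq_add_neg, ← neg_one_smul ℂ, mem_coHardy]
    intro k hk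
    rw [coeff_smul, coeff_add, coeff_smul, coeff_star, hcoef, hcoef, if_pos hk]
    rcases hk.eq_or_lt with rfl | hk
    · have : (starRingEnd ℂ) (P.coeff 0) = P.coeff 0 := Complex.conj_eq_iff_im.2 him
      simp [this]
    · rw [if_neg (by lia), Polynomial.coeff_C, if_neg (by lia)]
      simp

theorem norm_P2_rePart_le {q : ℝ≥0∞} [Fact (1 < q)] [Fact (1 ≤ q)] [hq2 : Fact (q ≤ 2)] :
    ∃ C : ℝ, 0 ≤ C ∧ ∀ P : Polynomial ℂ, (P.coeff 0).im = 0 →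
      (∀ t : T, 0 < (P.toAddCircle t).re) →
      ‖incl q hq2.out (P2 (toL 2 (rePart P.toAddCircle)))‖ ≤ C * ‖toL q (rePart P.toAddCircle)‖ := by
  have hqtop : q ≠ ∞ := (hq2.out.trans_lt ENNReal.ofNat_lt_top).ne
  have h1 : 1 < q.toReal := by
    rw [← ENNReal.toReal_one]
    exact (ENNReal.toReal_lt_toReal ENNReal.one_ne_top hqtop).2 Fact.out
  have h2 : q.toReal ≤ 2 := by
    rw [← ENNReal.toReal_ofNat]
    exact (ENNReal.toReal_le_toReal hqtop ENNReal.ofNat_ne_top).2 hq2.out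
  obtain ⟨A, hA, h⟩ := integral_poly_le h1 h2
  refine ⟨A ^ (q.toReal)⁻¹, by positivity, fun P him hpos => ?_⟩
  have hP := h P him hpos
  have hnorm : ‖toL q P.toAddCircle‖ ≤ A ^ (q.toReal)⁻¹ * ‖toL q (rePart P.toAddCircle)‖ := by
    rw [norm_toL, norm_toL]
    have e : ∫ t, ‖rePart P.toAddCircle t‖ ^ q.toReal ∂m =
        ∫ t, (P.toAddCircle t).re ^ q.toReal ∂m := by
      congr 1
      ext t
      simp only [rePart, ContinuousMap.coe_mk, Complex.norm_real, Real.norm_eq_abs,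
        abs_of_pos (hpos t)]
    have h0 : 0 ≤ ∫ t, (P.toAddCircle t).re ^ q.toReal ∂m :=
      integral_nonneg fun t => Real.rpow_nonneg (hpos t).le _
    rw [e, ← Real.mul_rpow hA h0]
    exact Real.rpow_le_rpow (integral_nonneg fun t => by positivity) hP (by positivity)
  rw [P2_rePart P him, incl_toL, map_smul, map_add, norm_smul]
  have hc : ‖toL q (Polynomial.C (P.coeff 0)).toAddCircle‖ ≤ ‖toL q P.toAddCircle‖ := by
    refine (norm_toL_le q _).trans ?_
    have h3 := norm_coeff_le (toL q P.toAddCircle) 0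
    rw [coeff_toL, Polynomial.fourierCoeff_toAddCircle] at h3
    refine le_trans ?_ h3
    rw [Polynomial.toAddCircle_C_eq_smul_fourier_zero, norm_smul, fourier_norm]
    simp
  have h4 := norm_add_le (toL q P.toAddCircle) (toL q (Polynomial.C (P.coeff 0)).toAddCircle)
  have h5 : ‖(1 / 2 : ℂ)‖ = 1 / 2 := by norm_num
  rw [h5]
  linarith

theorem exists_poly (g : C(T, ℂ)) {ε : ℝ} (hε : 0 < ε) :
    ∃ P : Polynomial ℂ, (P.coeff 0).im = 0 ∧ ‖rePart P.toAddCircle - rePart g‖ < ε := by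
  have hspan : ∀ f ∈ Submodule.span ℂ (range (@fourier (2 * π))),
      ∃ P : Polynomial ℂ, rePart f = rePart P.toAddCircle := by
    have hneg : ∀ f ∈ Submodule.span ℂ (range (@fourier (2 * π))),
      ∃ P Q : Polynomial ℂ, f = P.toAddCircle + star Q.toAddCircle := by
      intro f hf
      induction hf using Submodule.span_induction with
      | mem f hf =>
        obtain ⟨k, rfl⟩ := hf
        obtain ⟨n, rfl | rfl⟩ := k.eq_nat_or_neg
        · exact ⟨Polynomial.X ^ n, 0, by rw [Polynomial.toAddCircle_X_pow_eq_fourier]; simp⟩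
        · refine ⟨0, Polynomial.X ^ n, ?_⟩
          rw [Polynomial.toAddCircle_X_pow_eq_fourier]
          ext t
          rw [fourier_neg]
          simp
      | zero => exact ⟨0, 0, by simp⟩
      | add f g _ _ hf hg =>
        obtain ⟨P, Q, rfl⟩ := hf
        obtain ⟨P', Q', rfl⟩ := hg
        exact ⟨P + P', Q + Q', by simp only [map_add, star_add]; abel⟩
      | smul c f _ hf =>
        obtain ⟨P, Q, rfl⟩ := hf
        refine ⟨c • P, star c • Q, ?_⟩
        rw [map_smul, map_smul, smul_add, star_smul, star_star]
    intro f hf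
    obtain ⟨P, Q, rfl⟩ := hneg f hf
    exact ⟨P + Q, by ext t; simp [rePart]⟩
  have hg : g ∈ (Submodule.span ℂ (range (@fourier (2 * π)))).topologicalClosure := by
    rw [span_fourier_closure_eq_top]; trivial
  obtain ⟨f, hf, hfg⟩ := Metric.mem_closure_iff.1 hg ε hε
  obtain ⟨P, hP⟩ := hspan f hf
  refine ⟨P - Polynomial.C (((P.coeff 0).im : ℂ) * Complex.I), by simp, ?_⟩
  have e : rePart (P - Polynomial.C (((P.coeff 0).im : ℂ) * Complex.I)).toAddCircle = rePart f := by
    rw [hP]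
    ext t
    simp [rePart, toAddCircle_apply]
  rw [e]
  refine lt_of_le_of_lt ?_ ((dist_comm f g).trans_lt hfg)
  rw [dist_eq_norm, ContinuousMap.norm_le _ (norm_nonneg _)]
  intro t
  refine le_trans ?_ ((f - g).norm_coe_le_norm t)
  have : (rePart f - rePart g) t = (((f - g) t).re : ℂ) := by simp [rePart]
  rw [this, Complex.norm_real]
  exact Complex.abs_re_le_norm _

theorem norm_P2_nonneg_le {q : ℝ≥0∞} [Fact (1 < q)] [Fact (1 ≤ q)] [hq2 : Fact (q ≤ 2)] :
    ∃ C : ℝ, 0 ≤ C ∧ ∀ g : C(T, ℂ), (∀ t, 0 ≤ (g t).re) →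
      ‖incl q hq2.out (P2 (toL 2 (rePart g)))‖ ≤ C * ‖toL q (rePart g)‖ := by
  obtain ⟨C, hC, h⟩ := norm_P2_rePart_le (q := q)
  refine ⟨C, hC, fun g hg => le_of_forall_pos_le_add fun δ hδ => ?_⟩
  set ε : ℝ := δ / (3 * (1 + C)) with hε
  have hε0 : 0 < ε := by positivity
  obtain ⟨P, him, hP⟩ := exists_poly (g + ContinuousMap.const T ((2 * ε : ℝ) : ℂ)) hε0
  have hpt : ∀ t : T, |(P.toAddCircle t).re - ((g t).re + 2 * ε)| < ε := fun t => by
    have := ((rePart P.toAddCircle - rePart (g + ContinuousMap.const T ((2 * ε : ℝ) : ℂ))).norm_coe_le_norm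
      t).trans_lt hP
    have e : (rePart P.toAddCircle - rePart (g + ContinuousMap.const T ((2 * ε : ℝ) : ℂ))) t =
      (((P.toAddCircle t).re - ((g t).re + 2 * ε) : ℝ) : ℂ) := by simp [rePart]
    rwa [e, Complex.norm_real] at this
  have hpos : ∀ t : T, 0 < (P.toAddCircle t).re := fun t => by
    have := (abs_lt.1 (hpt t)).1
    have := hg t
    linarith
  have hd : ‖rePart P.toAddCircle - rePart g‖ ≤ 3 * ε := by
    rw [ContinuousMap.norm_le _ (by positivity)]
    intro t
    have e : (rePart P.toAddCircle - rePart g) t = (((P.toAddCircle t).re - (g t).re : ℝ) : ℂ) := by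
      simp [rePart]
    rw [e, Complex.norm_real, Real.norm_eq_abs, abs_le]
    have := abs_lt.1 (hpt t)
    constructor <;> linarith
  have h1 := h P him hpos
  have h2 : ‖incl q hq2.out (P2 (toL 2 (rePart P.toAddCircle))) -
      incl q hq2.out (P2 (toL 2 (rePart g)))‖ ≤ 3 * ε := by
    rw [← map_sub, ← map_sub, ← map_sub]
    exact (norm_incl_le _ _ _).trans ((norm_P2_le _).trans ((norm_toL_le 2 _).trans hd))
  have h3 : ‖toL q (rePart P.toAddCircle) - toL q (rePart g)‖ ≤ 3 * ε := by
    rw [← map_sub]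
    exact (norm_toL_le q _).trans hd
  have h4 := norm_sub_norm_le (toL q (rePart P.toAddCircle)) (toL q (rePart g))
  have h5 := norm_sub_norm_le (incl q hq2.out (P2 (toL 2 (rePart g))))
    (incl q hq2.out (P2 (toL 2 (rePart P.toAddCircle))))
  rw [norm_sub_rev] at h5
  have h6 : C * ‖toL q (rePart P.toAddCircle)‖ ≤ C * (‖toL q (rePart g)‖ + 3 * ε) :=
    mul_le_mul_of_nonneg_left (by linarith) hC
  have h7 : 3 * ε * (1 + C) = δ := by rw [hε]; field_simp
  nlinarith

theorem norm_toL_mono {q : ℝ≥0∞} [Fact (1 ≤ q)] {f g : C(T, ℂ)} (h : ∀ t, ‖f t‖ ≤ ‖g t‖) :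
    ‖toL q f‖ ≤ ‖toL q g‖ := by
  refine Lp.norm_le_norm_of_ae_le ?_
  filter_upwards [ContinuousMap.coeFn_toLp (p := q) (𝕜 := ℂ) m f,
    ContinuousMap.coeFn_toLp (p := q) (𝕜 := ℂ) m g] with t h1 h2
  rw [h1, h2]
  exact h t

theorem norm_P2_toL_le {q : ℝ≥0∞} [Fact (1 < q)] [Fact (1 ≤ q)] [hq2 : Fact (q ≤ 2)] :
    ∃ C : ℝ, 0 ≤ C ∧ ∀ g : C(T, ℂ), ‖incl q hq2.out (P2 (toL 2 g))‖ ≤ C * ‖toL q g‖ := by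
  obtain ⟨C, hC, h⟩ := norm_P2_nonneg_le (q := q)
  have hmax : ∀ u : C(T, ℝ), (∀ t, 0 ≤ u t) → ∀ g : C(T, ℂ), (∀ t, |u t| ≤ ‖g t‖) →
      ‖incl q hq2.out (P2 (toL 2 ⟨fun t => (u t : ℂ), by fun_prop⟩))‖ ≤ C * ‖toL q g‖ := by
    intro u hu g hg
    refine (h ⟨fun t => (u t : ℂ), by fun_prop⟩ (by simpa using hu)).trans
      (mul_le_mul_of_nonneg_left (norm_toL_mono fun t => ?_) hC)
    simpa [rePart] using hg t
  refine ⟨4 * C, by positivity, fun g => ?_⟩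
  have hre := fun t => Complex.abs_re_le_norm (g t)
  have him := fun t => Complex.abs_im_le_norm (g t)
  let u1 : C(T, ℝ) := ⟨fun t => max (g t).re 0, by fun_prop⟩
  let u2 : C(T, ℝ) := ⟨fun t => max (-(g t).re) 0, by fun_prop⟩
  let u3 : C(T, ℝ) := ⟨fun t => max (g t).im 0, by fun_prop⟩
  let u4 : C(T, ℝ) := ⟨fun t => max (-(g t).im) 0, by fun_prop⟩
  have hm : ∀ x y : ℝ, |x| ≤ y → |max x 0| ≤ y := fun x y hxy => by
    rw [abs_of_nonneg (le_max_right _ _)]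
    exact max_le ((le_abs_self x).trans hxy) ((abs_nonneg x).trans hxy)
  have k1 := hmax u1 (fun t => le_max_right _ _) g fun t => hm _ _ (hre t)
  have k2 := hmax u2 (fun t => le_max_right _ _) g fun t => hm _ _ (by simpa using hre t)
  have k3 := hmax u3 (fun t => le_max_right _ _) g fun t => hm _ _ (him t)
  have k4 := hmax u4 (fun t => le_max_right _ _) g fun t => hm _ _ (by simpa using him t)
  have hg : g = ((⟨fun t => (u1 t : ℂ), by fun_prop⟩ : C(T, ℂ)) - ⟨fun t => (u2 t : ℂ), by fun_prop⟩) +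
      Complex.I • ((⟨fun t => (u3 t : ℂ), by fun_prop⟩ : C(T, ℂ)) -
        ⟨fun t => (u4 t : ℂ), by fun_prop⟩) := by
    have hx : ∀ x : ℝ, max x 0 - max (-x) 0 = x := fun x => by
      rcases le_total x 0 with h | h <;> simp [h]
    ext t
    apply Complex.ext <;> simp [u1, u2, u3, u4, hx]
  rw [hg, map_add, map_add, map_add, map_smul, map_smul, map_smul, map_sub, map_sub, map_sub,
    map_sub, map_sub, map_sub, ← hg]
  refine (norm_add_le _ _).trans ?_
  rw [norm_smul, Complex.norm_I, one_mul]
  refine (add_le_add (norm_sub_le _ _) (norm_sub_le _ _)).trans ?_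
  linarith

/-- **M. Riesz's theorem**: `L^q` is the direct sum of `H^q` and the conjugate of `H^q_0`. -/
theorem isCompl_hardy (q : ℝ≥0∞) [Fact (1 < q)] [Fact (1 ≤ q)] [hq2 : Fact (q ≤ 2)] :
    IsCompl (hardy q) (coHardy q) := by
  refine ⟨disjoint_hardy q, ?_⟩
  rw [codisjoint_iff, Submodule.eq_top_iff']
  intro f
  have hqtop : q ≠ ∞ := (hq2.out.trans_lt ENNReal.ofNat_lt_top).ne
  obtain ⟨C, -, hC⟩ := norm_P2_toL_le (q := q)
  let F : C(T, ℂ) →ₗ[ℂ] L q :=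
    ((incl q hq2.out).toLinearMap ∘ₗ P2.toLinearMap) ∘ₗ (toL 2).toLinearMap
  have hd : DenseRange (toL q).toLinearMap := ContinuousMap.toLp_denseRange ℂ m ℂ hqtop
  let R := F.extendOfNorm (toL q).toLinearMap
  have hR : ∀ g : C(T, ℂ), R (toL q g) = incl q hq2.out (P2 (toL 2 g)) := fun g =>
    LinearMap.extendOfNorm_eq hd ⟨C, hC⟩ g
  have h1 : ∀ f : L q, R f ∈ hardy q := fun f => by
    refine hd.induction_on (p := fun f => R f ∈ hardy q) f
      ((isClosed_hardy q).preimage R.continuous) fun g => ?_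
    change R (toL q g) ∈ _
    rw [hR, mem_hardy]
    intro k hk
    rw [coeff_incl]
    exact mem_hardy.1 (P2_mem _) k hk
  have h2 : ∀ f : L q, f - R f ∈ coHardy q := fun f => by
    refine hd.induction_on (p := fun f => f - R f ∈ coHardy q) f
      ((isClosed_coHardy q).preimage (continuous_id.sub R.continuous)) fun g => ?_
    change toL q g - R (toL q g) ∈ _
    rw [hR, ← incl_toL q hq2.out, ← map_sub, mem_coHardy]
    intro k hk
    rw [coeff_incl]
    exact mem_coHardy.1 (sub_P2_mem _) k hk
  exact Submodule.mem_sup.2 ⟨R f, h1 f, f - R f, h2 f, by abel⟩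

theorem isTopCompl_hardy (q : ℝ≥0∞) [Fact (1 < q)] [Fact (1 ≤ q)] [Fact (q ≤ 2)] :
    Submodule.IsTopCompl (hardy q) (coHardy q) :=
  Submodule.IsCompl.isTopCompl_of_isClosed (isCompl_hardy q) (isClosed_hardy q) (isClosed_coHardy q)

instance {q : ℝ≥0∞} [h : Fact (1 < q)] : Fact (1 ≤ q) := ⟨h.out.le⟩

instance : Fact ((1 : ℝ≥0∞) < 2) := ⟨by norm_num⟩

instance : Fact ((2 : ℝ≥0∞) ≤ 2) := ⟨le_rfl⟩

/-- The product of scalar functions `f ∈ L^s`, `g ∈ L^t`, as an element of `L^r`, where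
`1 / s + 1 / t = 1 / r`. -/
abbrev mulS {s t r : ℝ≥0∞} [Fact (1 ≤ s)] [Fact (1 ≤ t)] [Fact (1 ≤ r)] [ENNReal.HolderTriple s t r]
    (f : L s) : L t →L[ℂ] L r :=
  (ContinuousLinearMap.mul ℂ ℂ).holderL m s t r f

theorem coeFn_mulS {s t r : ℝ≥0∞} [Fact (1 ≤ s)] [Fact (1 ≤ t)] [Fact (1 ≤ r)]
    [ENNReal.HolderTriple s t r] (f : L s) (g : L t) :
    (mulS f g : L r) =ᵐ[m] fun x => f x * g x :=
  (ContinuousLinearMap.mul ℂ ℂ).coeFn_holder f g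

theorem coeff_mulS_fourier {q : ℝ≥0∞} [Fact (1 ≤ q)] (f : L ∞) (j k : ℤ) :
    fourierCoeff (mulS f (fourierLp q j) : L q) k = fourierCoeff f (k - j) := by
  refine integral_congr_ae ?_
  filter_upwards [coeFn_mulS (r := q) f (fourierLp q j), coeFn_fourierLp (T := 2 * π) q j]
    with t h1 h2
  rw [h1, h2, show -(k - j) = -k + j by ring, fourier_add]
  simp only [smul_eq_mul]
  ring

theorem fourierLp_mem_hardy {q : ℝ≥0∞} [Fact (1 ≤ q)] {j : ℤ} (hj : 0 ≤ j) : (fourierLp q j : L q) ∈ hardy q := by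
  intro k hk
  rw [fourierCoeff_congr_ae (coeFn_fourierLp q j), fourierCoeff_fourier]
  exact Pi.single_eq_of_ne (by lia) _

theorem fourierLp_mem_coHardy {q : ℝ≥0∞} [Fact (1 ≤ q)] {j : ℤ} (hj : j < 0) : (fourierLp q j : L q) ∈ coHardy q := by
  rw [mem_coHardy]
  intro k hk
  rw [fourierCoeff_congr_ae (coeFn_fourierLp q j), fourierCoeff_fourier]
  exact Pi.single_eq_of_ne (by lia) _

section riesz

variable (q : ℝ≥0∞) [Fact (1 < q)] [hq2 : Fact (q ≤ 2)]

/-- The scalar Riesz projection of `L^q` onto `H^q`, along the conjugate of `H^q_0`. -/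
def rieszS : L q →L[ℂ] L q := (hardy q).projectionL (coHardy q) (isTopCompl_hardy q)

theorem rieszS_mem (f : L q) : rieszS q f ∈ hardy q :=
  Submodule.projectionL_apply_mem (isTopCompl_hardy q) f

theorem rieszS_of_mem {f : L q} (hf : f ∈ hardy q) : rieszS q f = f :=
  Submodule.projectionL_apply_left (isTopCompl_hardy q) ⟨f, hf⟩

theorem rieszS_eq_zero {f : L q} : rieszS q f = 0 ↔ f ∈ coHardy q :=
  Submodule.projectionL_apply_eq_zero_iff (isTopCompl_hardy q)

theorem sub_rieszS_mem (f : L q) : f - rieszS q f ∈ coHardy q := by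
  rw [← rieszS_eq_zero, map_sub, rieszS_of_mem q (rieszS_mem q f), sub_self]

variable {q}

theorem closed_induction {M : Submodule ℂ (L q)} (hM : IsClosed (M : Set (L q))) (Ψ : L q →L[ℂ] L q)
    (h : ∀ j, Ψ (fourierLp q j) ∈ M) (f : L q) : Ψ f ∈ M := by
  have hqtop : q ≠ ∞ := (hq2.out.trans_lt ENNReal.ofNat_lt_top).ne
  have hle : (Submodule.span ℂ (range (@fourierLp (2 * π) _ q _))).topologicalClosure ≤
      M.comap Ψ.toLinearMap := by
    refine Submodule.topologicalClosure_minimal _ ?_ (hM.preimage Ψ.continuous)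
    rw [Submodule.span_le]
    rintro _ ⟨j, rfl⟩
    exact h j
  rw [span_fourierLp_closure_eq_top hqtop] at hle
  exact hle (Submodule.mem_top (x := f))

theorem mulS_mem_hardy {f : L ∞} (hf : f ∈ hardy ∞) {g : L q} (hg : g ∈ hardy q) :
    (mulS f g : L q) ∈ hardy q := by
  have := closed_induction (isClosed_hardy q) (mulS f ∘L rieszS q) (fun j => ?_) g
  · simpa [rieszS_of_mem q hg] using this
  · rw [ContinuousLinearMap.comp_apply]
    rcases lt_or_ge j 0 with hj | hj
    · rw [(rieszS_eq_zero q).2 (fourierLp_mem_coHardy hj), map_zero]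
      exact zero_mem _
    · rw [rieszS_of_mem q (fourierLp_mem_hardy hj)]
      intro k hk
      rw [coeff_mulS_fourier]
      exact hf _ (by lia)

theorem mulS_star_mem_coHardy {f : L ∞} (hf : f ∈ hardy ∞) {g : L q} (hg : g ∈ coHardy q) :
    (mulS (star f) g : L q) ∈ coHardy q := by
  have := closed_induction (isClosed_coHardy q)
    (mulS (star f) ∘L (ContinuousLinearMap.id ℂ (L q) - rieszS q)) (fun j => ?_) g
  · rwa [ContinuousLinearMap.comp_apply, sub_apply, ContinuousLinearMap.id_apply,
      (rieszS_eq_zero q).2 hg, sub_zero] at this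
  · rw [ContinuousLinearMap.comp_apply, sub_apply, ContinuousLinearMap.id_apply]
    rcases lt_or_ge j 0 with hj | hj
    · rw [(rieszS_eq_zero q).2 (fourierLp_mem_coHardy hj), sub_zero, mem_coHardy]
      intro k hk
      rw [coeff_mulS_fourier, coeff_star, hf _ (by lia), star_zero]
    · rw [rieszS_of_mem q (fourierLp_mem_hardy hj), sub_self, map_zero]
      exact zero_mem _

end riesz

/-! ### Vector valued spaces and the operators -/

/-- The space `(L^q)^n` of column vectors. -/
abbrev V (n : ℕ) (q : ℝ≥0∞) : Type := Fin n → L q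

/-- The space of `n × n` matrices with entries in `L^p`. -/
abbrev Mat (n : ℕ) (p : ℝ≥0∞) : Type := Matrix (Fin n) (Fin n) (L p)

/-- The space `(H^q)^n`. -/
def hardyV (n : ℕ) (q : ℝ≥0∞) [Fact (1 ≤ q)] : Submodule ℂ (V n q) :=
  Submodule.pi univ fun _ => hardy q

/-- The space of the vectors with entries in the conjugate of `H^q_0`. -/
def coHardyV (n : ℕ) (q : ℝ≥0∞) [Fact (1 ≤ q)] : Submodule ℂ (V n q) :=
  Submodule.pi univ fun _ => coHardy q

/-- Multiplication of vector functions by a matrix function `M`: the `i`-th entry of `M f` is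
`∑ j, M i j * f j`. -/
def mulV {n : ℕ} {s t r : ℝ≥0∞} [Fact (1 ≤ s)] [Fact (1 ≤ t)] [Fact (1 ≤ r)]
    [ENNReal.HolderTriple s t r] (M : Mat n s) : V n t →L[ℂ] V n r :=
  ContinuousLinearMap.pi fun i => ∑ j, mulS (M i j) ∘L ContinuousLinearMap.proj j

theorem mulV_apply {n : ℕ} {s t r : ℝ≥0∞} [Fact (1 ≤ s)] [Fact (1 ≤ t)] [Fact (1 ≤ r)]
    [ENNReal.HolderTriple s t r] (M : Mat n s) (f : V n t) (i : Fin n) :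
    (mulV M f : V n r) i = ∑ j, mulS (M i j) (f j) := by
  simp [mulV]

/-- `Θ` is an `n × n` matrix inner function: its entries lie in `H^∞`, and its values are unitary
matrices almost everywhere on the circle. -/
structure IsInner {n : ℕ} (Θ : Mat n ∞) : Prop where
  mem_hardy : ∀ i j, Θ i j ∈ hardy ∞
  unitary : ∀ᵐ t ∂m, (Matrix.of fun i j => Θ i j t) ∈ Matrix.unitaryGroup (Fin n) ℂ

/-- The matricial model space `K_Θ^q`, the intersection of `Θ` times the conjugate of `(H^q_0)^n`
with `(H^q)^n`. -/
def modelSpace {n : ℕ} (Θ : Mat n ∞) (q : ℝ≥0∞) [Fact (1 ≤ q)] : Submodule ℂ (V n q) :=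
  (coHardyV n q).map (mulV Θ : V n q →L[ℂ] V n q).toLinearMap ⊓ hardyV n q

theorem mulV_mulV_star {n : ℕ} {q : ℝ≥0∞} [Fact (1 ≤ q)] {Θ : Mat n ∞} (hΘ : IsInner Θ) (f : V n q) :
    (mulV Θ (mulV Θᴴ f : V n q) : V n q) = f := by
  have hsum : ∀ (M : Mat n ∞) (g : V n q) (i : Fin n),
      ((mulV M g : V n q) i : T → ℂ) =ᵐ[m] fun t => ∑ j, M i j t * g j t := by
    intro M g i
    rw [mulV_apply]
    have h1 : ((∑ j, mulS (M i j) (g j) : L q) : T → ℂ) =ᵐ[m]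
        fun t => ∑ j, (mulS (M i j) (g j) : L q) t :=
      Lp.coeFn_fun_finsetSum _ _
    have h2 : ∀ᵐ t ∂m, ∀ j, (mulS (M i j) (g j) : L q) t = M i j t * g j t :=
      ae_all_iff.2 fun j => coeFn_mulS (M i j) (g j)
    filter_upwards [h1, h2] with t h1 h2
    rw [h1]
    exact Finset.sum_congr rfl fun j _ => h2 j
  funext i
  ext1
  have h1 : ∀ᵐ t ∂m, ∀ j, (mulV Θᴴ f : V n q) j t = ∑ k, Θᴴ j k t * f k t :=
    ae_all_iff.2 fun j => hsum _ _ j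
  have h2 : ∀ᵐ t ∂m, ∀ j k, Θᴴ j k t = star (Θ k j t) :=
    ae_all_iff.2 fun j => ae_all_iff.2 fun k => Lp.coeFn_star (Θ k j)
  filter_upwards [hsum Θ (mulV Θᴴ f) i, h1, h2, hΘ.unitary] with t h0 h1 h2 h3
  rw [h0]
  simp only [h1, h2]
  have h4 := congrFun (congrArg (fun A => A *ᵥ fun k => f k t) (Matrix.mem_unitaryGroup_iff.1 h3)) i
  simp only [← Matrix.mulVec_mulVec, Matrix.one_mulVec, Matrix.star_eq_conjTranspose] at h4
  simpa [Matrix.mulVec, dotProduct] using h4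

section vec

variable (n : ℕ) (q : ℝ≥0∞) [Fact (1 < q)] [hq2 : Fact (q ≤ 2)]

/-- The Riesz projection `P_{q+}` of `(L^q)^n` onto `(H^q)^n`. -/
def rieszPlus : V n q →L[ℂ] hardyV n q :=
  (ContinuousLinearMap.pi fun i => rieszS q ∘L ContinuousLinearMap.proj i).codRestrict (hardyV n q)
    fun f i _ => rieszS_mem q (f i)

/-- The complementary projection `P_{q-} = I - P_{q+}`. -/
def rieszMinus : V n q →L[ℂ] V n q :=
  ContinuousLinearMap.id ℂ (V n q) - (hardyV n q).subtypeL ∘L rieszPlus n q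

variable {n q}

theorem rieszPlus_apply (f : V n q) (i : Fin n) : (rieszPlus n q f : V n q) i = rieszS q (f i) := rfl

theorem rieszMinus_mem (f : V n q) : rieszMinus n q f ∈ coHardyV n q :=
  fun i _ => sub_rieszS_mem q (f i)

theorem mulV_star_mem {Θ : Mat n ∞} (hΘ : IsInner Θ) {f : V n q} (hf : f ∈ coHardyV n q) :
    (mulV Θᴴ f : V n q) ∈ coHardyV n q := by
  intro i _
  rw [mulV_apply]
  exact Submodule.sum_mem _ fun j _ => mulS_star_mem_coHardy (hΘ.mem_hardy j i) (hf j trivial)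

theorem pTheta_mem {Θ : Mat n ∞} (hΘ : IsInner Θ) (f : V n q) :
    (rieszPlus n q (mulV Θ (rieszMinus n q (mulV Θᴴ f))) : V n q) ∈ modelSpace Θ q := by
  refine ⟨?_, (rieszPlus n q _).2⟩
  have hb : rieszMinus n q (mulV Θᴴ f) ∈ coHardyV n q := rieszMinus_mem _
  generalize rieszMinus n q (mulV Θᴴ f) = b at hb
  have hc : rieszMinus n q (mulV Θ b) ∈ coHardyV n q := rieszMinus_mem _
  have hbc : (rieszPlus n q (mulV Θ b) : V n q) = mulV Θ b - rieszMinus n q (mulV Θ b) :=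
    (sub_sub_cancel (mulV Θ b : V n q) _).symm
  generalize rieszMinus n q (mulV Θ b) = c at hc hbc
  rw [hbc]
  refine ⟨b - mulV Θᴴ c, sub_mem hb (mulV_star_mem hΘ hc), ?_⟩
  rw [ContinuousLinearMap.coe_coe, map_sub, mulV_mulV_star hΘ]

/-- The projection `P_{Θ,q} = P_{q+} Θ P_{q-} Θ^*` of `(L^q)^n` onto `K_Θ^q`. -/
def pTheta (Θ : Mat n ∞) (hΘ : IsInner Θ) (q : ℝ≥0∞) [Fact (1 < q)] [Fact (q ≤ 2)] :
    V n q →L[ℂ] modelSpace Θ q :=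
  ContinuousLinearMap.codRestrict
    ((hardyV n q).subtypeL ∘L rieszPlus n q ∘L (mulV Θ : V n q →L[ℂ] V n q) ∘L rieszMinus n q ∘L
      (mulV Θᴴ : V n q →L[ℂ] V n q))
    (modelSpace Θ q) fun f => by
      simp only [ContinuousLinearMap.comp_apply, Submodule.subtypeL_apply]
      exact pTheta_mem hΘ f

theorem coe_pTheta (Θ : Mat n ∞) (hΘ : IsInner Θ) (q : ℝ≥0∞) [Fact (1 < q)] [Fact (q ≤ 2)]
    (f : V n q) : (pTheta Θ hΘ q f : V n q) =
      rieszPlus n q (mulV Θ (rieszMinus n q (mulV Θᴴ f)) : V n q) := rfl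

end vec

/-- The exponent `q` with `1 / q = 1 / 2 + 1 / p`. -/
def qExp (p : ℝ≥0∞) : ℝ≥0∞ := (1 / 2 + 1 / p)⁻¹

instance (p : ℝ≥0∞) [h : Fact (2 < p)] : Fact (1 ≤ p) := ⟨(one_le_two.trans h.out.le)⟩

instance (p : ℝ≥0∞) : ENNReal.HolderTriple p 2 (qExp p) :=
  ⟨by simp [qExp, add_comm]⟩

instance (p : ℝ≥0∞) : Fact (qExp p ≤ 2) :=
  ⟨by
    rw [qExp, ENNReal.inv_le_iff_inv_le]
    simp⟩

instance (p : ℝ≥0∞) [h : Fact (2 < p)] : Fact (1 < qExp p) :=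
  ⟨by
    rw [qExp, ENNReal.lt_inv_iff_lt_inv, inv_one, one_div, one_div]
    calc (2 : ℝ≥0∞)⁻¹ + p⁻¹ < 2⁻¹ + 2⁻¹ :=
          ENNReal.add_lt_add_left (by simp) (ENNReal.inv_lt_inv.2 h.out)
      _ = 1 := ENNReal.inv_two_add_inv_two⟩

section operators

variable {n : ℕ} {p : ℝ≥0∞} [Fact (2 < p)]

/-- The modified matrix-valued truncated Toeplitz operator `K_Θ^2 → K_Θ^q`,
`f ↦ P_{Θ,q} (G f)`. -/
def modifiedMTTO (Θ : Mat n ∞) (hΘ : IsInner Θ) (G : Mat n p) :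
    modelSpace Θ 2 →L[ℂ] modelSpace Θ (qExp p) :=
  pTheta Θ hΘ (qExp p) ∘L mulV G ∘L (modelSpace Θ 2).subtypeL

/-- The Toeplitz operator with the block symbol `[Θ^*, 0; G, Θ]`, which sends `(f₁, f₂)` to
`(P_{2+} (Θ^* f₁), P_{q+} (G f₁ + Θ f₂))`. A column vector of length `2 n` is the pair of its upper
and lower halves. -/
def toeplitzBlock (Θ : Mat n ∞) (G : Mat n p) :
    (hardyV n 2 × hardyV n (qExp p)) →L[ℂ] (hardyV n 2 × hardyV n (qExp p)) :=
  (rieszPlus n 2 ∘L mulV Θᴴ ∘L (hardyV n 2).subtypeL ∘L ContinuousLinearMap.fst ℂ _ _).prod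
    (rieszPlus n (qExp p) ∘L
      (mulV G ∘L (hardyV n 2).subtypeL ∘L ContinuousLinearMap.fst ℂ _ _ +
        mulV Θ ∘L (hardyV n (qExp p)).subtypeL ∘L ContinuousLinearMap.snd ℂ _ _))

theorem modifiedMTTO_apply (Θ : Mat n ∞) (hΘ : IsInner Θ) (G : Mat n p) (f : modelSpace Θ 2) :
    modifiedMTTO Θ hΘ G f = pTheta Θ hΘ (qExp p) (mulV G (f : V n 2)) := rfl

theorem toeplitzBlock_apply (Θ : Mat n ∞) (G : Mat n p) (f₁ : hardyV n 2)
    (f₂ : hardyV n (qExp p)) :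
    toeplitzBlock Θ G (f₁, f₂) =
      (rieszPlus n 2 (mulV Θᴴ (f₁ : V n 2)),
        rieszPlus n (qExp p) ((mulV G (f₁ : V n 2) : V n (qExp p)) +
          (mulV Θ (f₂ : V n (qExp p)) : V n (qExp p)))) := rfl

/-- The projection `P_n` of the column vectors of length `2 n` onto the first `n` coordinates. -/
def firstCoords (n : ℕ) (q : ℝ≥0∞) [Fact (1 ≤ q)] :
    (hardyV n 2 × hardyV n q) →L[ℂ] hardyV n 2 :=
  ContinuousLinearMap.fst ℂ (hardyV n 2) (hardyV n q)

end operators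

end MTTO

end

/-! ### Matrix multiplication pointwise, and cancellation of an inner function. -/

namespace MTTO

/-! A function `f₁` of `(H^2)^n` is the first half of a vector in the kernel of the block Toeplitz
operator exactly if two conditions hold: `P_{2+} (Θ^* f₁) = 0`, and some `f₂` in `(H^q)^n` satisfies
`P_{q+} (G f₁ + Θ f₂) = 0`. Each of them is one half of being in the kernel of the modified
truncated Toeplitz operator.

The first condition says that `Θ^* f₁` lies in the conjugate of `(H^2_0)^n`. As `Θ` is unitary
almost everywhere, this means that `f₁` lies in `Θ` times that space, that is, in `K_Θ^2`
(`mem_modelSpace_iff`).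

The second condition says that `h = G f₁`, which lies in `(L^q)^n` by Hölder's inequality, belongs
to the sum of `Θ (H^q)^n` and the conjugate of `(H^q_0)^n`. The heart of the proof is that this sum
is the kernel of `P_{Θ,q}` (`pTheta_eq_zero_iff`). Since `Θ Θ^* = I`, one has `P_{Θ,q} h = P_{q+} (h
- Θ P_{q+} Θ^* h)`, so if this vanishes, `f₂ = -P_{q+} Θ^* h` is a solution. Conversely,
multiplication by `Θ^*` preserves the conjugate of `(H^q_0)^n`, and this forces any solution to be
that one. -/

/-- Unitarity of `Θ` is a statement about its values at almost every point; this formula brings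
identities between classes in `L^r` down to that level. -/
theorem coeFn_mulV {n : ℕ} {s t r : ℝ≥0∞} [Fact (1 ≤ s)] [Fact (1 ≤ t)] [Fact (1 ≤ r)]
    [ENNReal.HolderTriple s t r] (M : Mat n s) (f : V n t) (i : Fin n) :
    ((mulV M f : V n r) i : T → ℂ) =ᵐ[m] fun x => ∑ j, M i j x * f j x := by
  rw [mulV_apply]
  have h1 : ((∑ j, mulS (M i j) (f j) : L r) : T → ℂ) =ᵐ[m]
      fun x => ∑ j, (mulS (M i j) (f j) : L r) x :=
    Lp.coeFn_fun_finsetSum _ _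
  have h2 : ∀ᵐ x ∂m, ∀ j, (mulS (M i j) (f j) : L r) x = M i j x * f j x :=
    ae_all_iff.2 fun j => coeFn_mulS (M i j) (f j)
  filter_upwards [h1, h2] with x h1 h2
  rw [h1]
  exact Finset.sum_congr rfl fun j _ => h2 j

/-- The values of `Θ` are square unitary matrices, so `Θ^* Θ = I` holds almost everywhere along with
`Θ Θ^* = I`, which gave `mulV_mulV_star`. The present order of the factors recovers `b` from `Θ b`.
-/
theorem mulV_star_mulV {n : ℕ} {q : ℝ≥0∞} [Fact (1 ≤ q)] {Θ : Mat n ∞} (hΘ : IsInner Θ)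
    (f : V n q) : (mulV Θᴴ (mulV Θ f : V n q) : V n q) = f := by
  funext i
  ext1
  have h1 : ∀ᵐ t ∂m, ∀ j, (mulV Θ f : V n q) j t = ∑ k, Θ j k t * f k t :=
    ae_all_iff.2 fun j => coeFn_mulV Θ f j
  have h2 : ∀ᵐ t ∂m, ∀ j k, Θᴴ j k t = star (Θ k j t) :=
    ae_all_iff.2 fun j => ae_all_iff.2 fun k => Lp.coeFn_star (Θ k j)
  filter_upwards [coeFn_mulV (r := q) Θᴴ (mulV Θ f : V n q) i, h1, h2, hΘ.unitary] with t h0 h1 h2 h3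
  rw [h0]
  simp only [h1, h2]
  -- The matrix identity `Θ(t)^* Θ(t) = I` is applied to the vector `f(t)`, and its `i`-th entry is
  -- read off.
  have h4 := congrFun (congrArg (fun A => A *ᵥ fun k => f k t)
    (Matrix.mem_unitaryGroup_iff'.1 h3)) i
  simp only [← Matrix.mulVec_mulVec, Matrix.one_mulVec, Matrix.star_eq_conjTranspose] at h4
  simpa [Matrix.mulVec, dotProduct] using h4

/-! ### Kernels of the Riesz projection, of the Toeplitz operator of `Θ^*`, and of `P_{Θ,q}`. -/

section

variable {n : ℕ} {q : ℝ≥0∞} [Fact (1 < q)] [Fact (q ≤ 2)]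

/-- The projection acts entry by entry, and each scalar projection is along the conjugate of
`H^q_0`. Every kernel condition below is turned into membership in this way. -/
theorem rieszPlus_eq_zero {f : V n q} : rieszPlus n q f = 0 ↔ f ∈ coHardyV n q := by
  rw [Subtype.ext_iff, funext_iff, coHardyV, Submodule.mem_pi]
  simp only [rieszPlus_apply, mem_univ, forall_const]
  exact forall_congr' fun i => rieszS_eq_zero q

theorem rieszPlus_of_mem {f : V n q} (hf : f ∈ hardyV n q) : (rieszPlus n q f : V n q) = f :=
  funext fun i => rieszS_of_mem q (hf i trivial)

theorem rieszMinus_apply (f : V n q) : rieszMinus n q f = f - (rieszPlus n q f : V n q) := rfl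

/-- A vector of `(H^q)^n` lies in `K_Θ^q` exactly if it is in the kernel of the Toeplitz operator
with symbol `Θ^*`. -/
theorem mem_modelSpace_iff {Θ : Mat n ∞} (hΘ : IsInner Θ) {f : V n q} (hf : f ∈ hardyV n q) :
    f ∈ modelSpace Θ q ↔ rieszPlus n q (mulV Θᴴ f) = 0 := by
  rw [rieszPlus_eq_zero]
  constructor
  -- If `f = Θ b`, then `Θ^* f` is `b` itself.
  · rintro ⟨⟨b, hb, rfl⟩, -⟩
    rw [ContinuousLinearMap.coe_coe, mulV_star_mulV hΘ]
    exact hb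
  -- The preimage of `f` under `Θ` is `Θ^* f`, because `Θ Θ^* = I`.
  · exact fun h => ⟨⟨_, h, mulV_mulV_star hΘ f⟩, hf⟩

/-- The kernel of `P_{Θ,q}` is the sum of `Θ (H^q)^n` and the conjugate of `(H^q_0)^n`. -/
theorem pTheta_eq_zero_iff {Θ : Mat n ∞} (hΘ : IsInner Θ) (h : V n q) :
    pTheta Θ hΘ q h = 0 ↔ ∃ g : hardyV n q, rieszPlus n q (h + mulV Θ (g : V n q)) = 0 := by
  rw [Subtype.ext_iff, coe_pTheta, ZeroMemClass.coe_zero, ZeroMemClass.coe_eq_zero]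
  constructor
  · intro h0
    -- The witness is read off from `Θ P_{q-} Θ^* h = h - Θ P_{q+} Θ^* h`.
    refine ⟨-rieszPlus n q (mulV Θᴴ h), ?_⟩
    rwa [rieszMinus_apply, map_sub, mulV_mulV_star hΘ, sub_eq_add_neg, ← map_neg] at h0
  · rintro ⟨g, hg⟩
    rw [rieszPlus_eq_zero] at hg
    -- Put `c = h + Θ g`, in the conjugate of `(H^q_0)^n`. Then `Θ^* h = Θ^* c - g` splits `Θ^* h`
    -- into its two Riesz components: `Θ^* c` stays in the conjugate of `(H^q_0)^n`, since the
    -- entries of `Θ` are analytic, and `g` is in `(H^q)^n`.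
    have h1 : rieszMinus n q (mulV Θᴴ h) = mulV Θᴴ (h + mulV Θ (g : V n q)) := by
      have h2 := rieszPlus_eq_zero.2 (mulV_star_mem hΘ hg)
      rw [map_add, mulV_star_mulV hΘ, map_add, ← eq_neg_iff_add_eq_zero] at h2
      rw [rieszMinus_apply, h2, map_add, mulV_star_mulV hΘ, Submodule.coe_neg,
        rieszPlus_of_mem g.2, sub_neg_eq_add]
    -- Hence `Θ P_{q-} Θ^* h = Θ Θ^* c = c`, which `P_{q+}` annihilates.
    rw [h1, mulV_mulV_star hΘ, rieszPlus_eq_zero]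
    exact hg

end

end MTTO

/-! ### The equality of the kernels. -/

/-- One side consists of elements of `(H^2)^n` and the other of elements of `K_Θ^2`, so both are
carried into `(L^2)^n` by the inclusions in order to be compared. The two kernel lemmas are used at
different exponents: `mem_modelSpace_iff` at `2`, `pTheta_eq_zero_iff` at `qExp p`. -/
theorem mainTheorem9 (n : ℕ) (p : ℝ≥0∞) [Fact (2 < p)]
    (Θ : MTTO.Mat n ∞) (hΘ : MTTO.IsInner Θ) (G : MTTO.Mat n p) :
    (((LinearMap.ker (MTTO.toeplitzBlock Θ G).toLinearMap).map
        (MTTO.firstCoords n (MTTO.qExp p)).toLinearMap).map (MTTO.hardyV n 2).subtype) =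
      (LinearMap.ker (MTTO.modifiedMTTO Θ hΘ G).toLinearMap).map (MTTO.modelSpace Θ 2).subtype := by
  ext f
  constructor
  · rintro ⟨_, ⟨⟨f₁, f₂⟩, hf, rfl⟩, rfl⟩
    rw [SetLike.mem_coe, LinearMap.mem_ker, ContinuousLinearMap.coe_coe,
      MTTO.toeplitzBlock_apply, Prod.mk_eq_zero] at hf
    refine ⟨⟨f₁, (MTTO.mem_modelSpace_iff hΘ f₁.2).2 hf.1⟩, ?_, rfl⟩
    rw [SetLike.mem_coe, LinearMap.mem_ker, ContinuousLinearMap.coe_coe,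
      MTTO.modifiedMTTO_apply, MTTO.pTheta_eq_zero_iff]
    exact ⟨f₂, hf.2⟩
  · rintro ⟨f, hf, rfl⟩
    rw [SetLike.mem_coe, LinearMap.mem_ker, ContinuousLinearMap.coe_coe,
      MTTO.modifiedMTTO_apply, MTTO.pTheta_eq_zero_iff] at hf
    obtain ⟨g, hg⟩ := hf
    -- The component `f.2.2` is the half of membership in `K_Θ^2` that places `f` in `(H^2)^n`; `g`
    -- serves as the lower half of the vector.
    refine ⟨⟨f, f.2.2⟩, ⟨(⟨f, f.2.2⟩, g), ?_, rfl⟩, rfl⟩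
    rw [SetLike.mem_coe, LinearMap.mem_ker, ContinuousLinearMap.coe_coe,
      MTTO.toeplitzBlock_apply, Prod.mk_eq_zero]
    exact ⟨(MTTO.mem_modelSpace_iff hΘ f.2.2).1 f.2, hg⟩
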